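/- Let $\mathcal A=\{A_1,\dots,A_m\}\subset\mathbb R^{n\times n}$ be a finite set of matrices constrained by an automaton, that is, a strongly connected labelled directed graph $G=(V,E)$ with finite node set $V$ and nonempty arc set $E\subseteq V\times V\times\{1,\dots,m\}$, where $(u,v,\sigma)\in E$ is an arc from $u$ to $v$ with label $\sigma$. Let $E_k$ be the set of paths of length $k$ in $G$. For a path $s\in E_k$ with labels $\sigma_1,\dots,\sigma_k$ put $A_s=A_{\sigma_k}\cdots A_{\sigma_1}$, and let $s(1)$ and $s(k+1)$ be its first and last nodes. Let $A(G)$ be the adjacency matrix of $G$ ($A(G)_{uv}$ is the number of arcs from $u$ to $v$), let $\rho(\cdot)$ be the spectral radius of a matrix, let $e_v$ ($v\in V$) be the canonical basis of $\mathbb R^V$, and let $\otimes$ be the Kronecker product. The constrained $p$-radius is $$\rho_p(G,\mathcal A)=\lim_{k\to\infty}\Big[|E_k|^{-1}\sum_{v\in V}\ \sum_{s\in E_k,\ s(1)=v}\|A_s\|^p\Big]^{\frac1{pk}} ,$$ where $\|\cdot\|$ is any norm on $\mathbb R^{n\times n}$. For an integer $d\ge 1$ let $x^{[d]}$ be the vector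 of the scaled monomials $\sqrt{\tfrac{d!}{\alpha_1!\cdots\alpha_n!}}\,x_1^{\alpha_1}\cdots x_n^{\alpha_n}$ with $\alpha_1+\cdots+\alpha_n=d$. For $A\in\mathbb R^{n\times n}$ let $A^{[d]}$ be the unique matrix with $(Ax)^{[d]}=A^{[d]}x^{[d]}$ for all $x\in\mathbb R^n$, and let $\mathcal A^{[d]}=\{A_1^{[d]},\dots,A_m^{[d]}\}$. A cone is proper if it is closed, solid (it has nonempty interior), convex and pointed. A set of matrices leaves a proper cone $K$ invariant if each of its matrices maps $K$ into $K$. **Theorem.** (1) Let $p\ge 1$ be an integer. If $\mathcal A^{[p]}$ leaves a proper cone invariant, then the limit defining $\rho_p(G,\mathcal A)$ and the limit below exist, for any choice of the norms, and $$\rho_p(G,\mathcal A)=\frac1{\rho(A(G))^{1/p}}\lim_{k\to\infty}\Big\|\sum_{s\in E_k}(e_{s(k+1)}e_{s(1)}^{\top})\otimes A_s^{[p]}\Big\|^{\frac1{pk}}=\frac1{\rho(A(G))^{1/p}}\ \rho\Big(\sum_{(u,v,\sigma)\in E}(e_ve_u^{\top})\otimes A_\sigma^{[p]}\Big)^{\frac1p}.$$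 (2) For every integer $d\ge1$, the set of coordinate vectors $c$ for which the form $\langle c,x^{[2d]}\rangle$ is a sum of squares of polynomials is a proper cone, and $\mathcal A^{[2d]}$ leaves it invariant. Consequently the identities of (1) hold for $p=2d$ without any assumption on $\mathcal A$. -/

import Mathlib

open Filter Topology
open scoped Kronecker

/-! ### Automata, paths and products of matrices along paths -/

/-- A labelled directed graph on the node set `V`, with arcs `(u, v, σ)` from `u` to `v`
labelled by `σ ∈ Fin m`. -/
structure Automaton (V : Type*) (m : ℕ) where
  edges : Finset (V × V × Fin m)

namespace Automaton

variable {V : Type*} {m : ℕ}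

/-- Any node can be reached from any other node by following arcs. -/
def StronglyConnected (G : Automaton V m) : Prop :=
  ∀ u v : V, Relation.ReflTransGen (fun a b => ∃ σ, (a, b, σ) ∈ G.edges) u v

variable [Fintype V] [DecidableEq V]

/-- The paths of length `k`. A path is recorded by its `k + 1` successive nodes and the `k`
labels of its arcs: the `i`-th arc is `(s.1 i.castSucc, s.1 i.succ, s.2 i)`. -/
def paths (G : Automaton V m) (k : ℕ) : Finset ((Fin (k + 1) → V) × (Fin k → Fin m)) :=
  Finset.univ.filter fun s => ∀ i : Fin k, (s.1 i.castSucc, s.1 i.succ, s.2 i) ∈ G.edges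

/-- The paths of length `k` that start at the node `v`. -/
def pathsFrom (G : Automaton V m) (k : ℕ) (v : V) :
    Finset ((Fin (k + 1) → V) × (Fin k → Fin m)) :=
  (G.paths k).filter fun s => s.1 0 = v

/-- The adjacency matrix: its `(u, v)` entry is the number of arcs from `u` to `v`. -/
def adjacency (G : Automaton V m) : Matrix V V ℝ :=
  Matrix.of fun u v => (((Finset.univ : Finset (Fin m)).filter
    fun σ => (u, v, σ) ∈ G.edges).card : ℝ)

end Automaton

/-- The product `A_{σ_k} ⋯ A_{σ_1}` for `(σ_1, …, σ_k) = w`. -/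
def wordProd {n m k : ℕ} (A : Fin m → Matrix (Fin n) (Fin n) ℝ) (w : Fin k → Fin m) :
    Matrix (Fin n) (Fin n) ℝ :=
  (List.ofFn fun i => A (w i)).reverse.prod

/-! ### Spectral radius and norms -/

/-- The spectral radius of a real matrix: the largest modulus of its complex eigenvalues. -/
noncomputable def realSpectralRadius {ι : Type*} [Fintype ι] [DecidableEq ι]
    (M : Matrix ι ι ℝ) : ℝ :=
  (spectralRadius ℂ (M.map (algebraMap ℝ ℂ))).toReal

/-- A seminorm that is a norm. -/
def IsNorm {E : Type*} [AddCommGroup E] [Module ℝ E] (ν : Seminorm ℝ E) : Prop :=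
  ∀ x, ν x = 0 → x = 0

/-! ### The constrained `p`-radius -/

section PRadius

variable {V : Type*} [Fintype V] [DecidableEq V] {n m : ℕ}

/-- The sum of `‖A_s‖ ^ p` over the paths `s` of length `k` starting at `v`. -/
noncomputable def outPowerSum (G : Automaton V m) (A : Fin m → Matrix (Fin n) (Fin n) ℝ)
    (ν : Seminorm ℝ (Matrix (Fin n) (Fin n) ℝ)) (p : ℝ) (k : ℕ) (v : V) : ℝ :=
  ∑ s ∈ G.pathsFrom k v, ν (wordProd A s.2) ^ p

/-- The sequence whose limit is the constrained `p`-radius. -/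
noncomputable def pRadiusSeq (G : Automaton V m) (A : Fin m → Matrix (Fin n) (Fin n) ℝ)
    (ν : Seminorm ℝ (Matrix (Fin n) (Fin n) ℝ)) (p : ℝ) (k : ℕ) : ℝ :=
  (((G.paths k).card : ℝ)⁻¹ * ∑ v, outPowerSum G A ν p k v) ^ (1 / (p * k))

/-- The constrained `p`-radius, computed with the matrix norm `ν`. -/
noncomputable def constrainedPRadius (G : Automaton V m)
    (A : Fin m → Matrix (Fin n) (Fin n) ℝ)
    (ν : Seminorm ℝ (Matrix (Fin n) (Fin n) ℝ)) (p : ℝ) : ℝ :=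
  limUnder atTop (pRadiusSeq G A ν p)

end PRadius

/-! ### The symmetric lift `A ↦ A^{[d]}` -/

/-- The exponents of the monomials of degree `d` in `n` variables. -/
abbrev HomExp (n d : ℕ) : Type :=
  {α : Fin n →₀ ℕ // α ∈ Finset.finsuppAntidiag (Finset.univ : Finset (Fin n)) d}

/-- The scaling factor `√(d! / (α₁! ⋯ αₙ!))`. -/
noncomputable def scaling {n d : ℕ} (α : HomExp n d) : ℝ :=
  Real.sqrt (Nat.multinomial Finset.univ α.1 : ℝ)

/-- The vector `x^{[d]}` of the values at `x` of the scaled monomials of degree `d`. -/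
noncomputable def scaledMonomials {n : ℕ} (d : ℕ) (x : Fin n → ℝ) : HomExp n d → ℝ :=
  fun α => scaling α * ∏ i, x i ^ α.1 i

/-- The form `⟨c, x^{[d]}⟩` of degree `d` whose coordinates in the scaled monomial basis
are `c`. -/
noncomputable def formOfCoords {n d : ℕ} (c : HomExp n d → ℝ) : MvPolynomial (Fin n) ℝ :=
  ∑ α : HomExp n d, MvPolynomial.monomial α.1 (c α * scaling α)

/-- The monomial `X^α` evaluated at the linear forms `A X`. -/
noncomputable def substMonomial {n : ℕ} (A : Matrix (Fin n) (Fin n) ℝ) (α : Fin n →₀ ℕ) :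
    MvPolynomial (Fin n) ℝ :=
  ∏ i, (∑ j, MvPolynomial.C (A i j) * MvPolynomial.X j) ^ α i

/-- The lift `A^{[d]}`: the unique matrix with `(A x)^{[d]} = A^{[d]} x^{[d]}` for all `x`
(see `existsUnique_symLift`), written out through the coefficients of `substMonomial A α`. -/
noncomputable def symLift {n : ℕ} (d : ℕ) (A : Matrix (Fin n) (Fin n) ℝ) :
    Matrix (HomExp n d) (HomExp n d) ℝ :=
  Matrix.of fun α β => scaling α / scaling β * (substMonomial A α.1).coeff β.1

theorem scaling_pos {n d : ℕ} (α : HomExp n d) : 0 < scaling α :=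
  Real.sqrt_pos.2 (by exact_mod_cast Nat.multinomial_pos _ _)

theorem substMonomial_isHomogeneous {n d : ℕ} (A : Matrix (Fin n) (Fin n) ℝ)
    (α : HomExp n d) : (substMonomial A α.1).IsHomogeneous d := by
  have h : ∑ i, 1 * α.1 i = d := by
    simpa using (Finset.mem_finsuppAntidiag.1 α.2).1
  have h2 := MvPolynomial.IsHomogeneous.prod (Finset.univ : Finset (Fin n))
    (fun i => (∑ j, MvPolynomial.C (A i j) * MvPolynomial.X j : MvPolynomial (Fin n) ℝ) ^ α.1 i)
    (fun i => 1 * α.1 i) (fun i _ => MvPolynomial.IsHomogeneous.pow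
      (MvPolynomial.IsHomogeneous.sum _ _ _ fun j _ =>
        MvPolynomial.isHomogeneous_C_mul_X _ _) _)
  rw [h] at h2
  exact h2

theorem symLift_mulVec {n d : ℕ} (A : Matrix (Fin n) (Fin n) ℝ) (x : Fin n → ℝ) :
    (symLift d A).mulVec (scaledMonomials d x) = scaledMonomials d (A.mulVec x) := by
  funext α
  have hP : (MvPolynomial.eval x) (substMonomial A α.1) = ∏ i, A.mulVec x i ^ α.1 i := by
    simp [substMonomial, Matrix.mulVec, dotProduct]
  have hsub : (substMonomial A α.1).support ⊆
      Finset.finsuppAntidiag (Finset.univ : Finset (Fin n)) d := by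
    intro β hβ
    have h := substMonomial_isHomogeneous A α (MvPolynomial.mem_support_iff.1 hβ)
    rw [Finset.mem_finsuppAntidiag]
    refine ⟨?_, Finset.subset_univ _⟩
    simpa [Finsupp.weight_apply, Finsupp.sum_fintype] using h
  have hE : ∑ β : HomExp n d, (substMonomial A α.1).coeff β.1 * ∏ i, x i ^ β.1 i =
      ∏ i, A.mulVec x i ^ α.1 i := by
    rw [← hP, MvPolynomial.eval_eq']
    rw [Finset.sum_subset hsub (by
      intro β _ hβ
      rw [MvPolynomial.notMem_support_iff.1 hβ, zero_mul])]
    exact Finset.sum_coe_sort (Finset.finsuppAntidiag (Finset.univ : Finset (Fin n)) d)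
      (fun β => (substMonomial A α.1).coeff β * ∏ i, x i ^ β i)
  simp only [scaledMonomials, symLift, Matrix.mulVec, dotProduct, Matrix.of_apply] at hE ⊢
  rw [← hE, Finset.mul_sum]
  refine Finset.sum_congr rfl fun β _ => ?_
  have := (scaling_pos β).ne'
  field_simp

theorem eval_formOfCoords {n d : ℕ} (c : HomExp n d → ℝ) (x : Fin n → ℝ) :
    MvPolynomial.eval x (formOfCoords c) = c ⬝ᵥ scaledMonomials d x := by
  simp only [formOfCoords, map_sum, MvPolynomial.eval_monomial, dotProduct, scaledMonomials,
    Finsupp.prod_fintype _ _ (fun i => pow_zero _), mul_assoc]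

theorem coeff_formOfCoords {n d : ℕ} (c : HomExp n d → ℝ) (α : HomExp n d) :
    (formOfCoords c).coeff α.1 = c α * scaling α := by
  classical
  simp only [formOfCoords, MvPolynomial.coeff_sum, MvPolynomial.coeff_monomial]
  rw [Finset.sum_eq_single α]
  · simp
  · intro β _ hβ
    rw [if_neg (fun h => hβ (Subtype.ext h))]
  · simp

/-- `symLift d A` is the unique matrix with `(A x)^{[d]} = A^{[d]} x^{[d]}` for all `x`. -/
theorem existsUnique_symLift {n d : ℕ} (A : Matrix (Fin n) (Fin n) ℝ)
    (B : Matrix (HomExp n d) (HomExp n d) ℝ) :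
    (∀ x, B.mulVec (scaledMonomials d x) = scaledMonomials d (A.mulVec x)) ↔
      B = symLift d A := by
  constructor
  · intro h
    funext α β
    have h1 : formOfCoords (B α) = formOfCoords (symLift d A α) := by
      refine MvPolynomial.funext fun x => ?_
      rw [eval_formOfCoords, eval_formOfCoords]
      exact congrFun ((h x).trans (symLift_mulVec A x).symm) α
    have h2 := congrArg (fun q => MvPolynomial.coeff β.1 q) h1
    simp only [coeff_formOfCoords] at h2
    exact mul_right_cancel₀ (scaling_pos β).ne' h2
  · rintro rfl x
    exact symLift_mulVec A x

/-! ### Proper cones and the cone of sums of squares -/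

/-- A proper cone: closed under multiplication by nonnegative scalars, convex, closed, solid
(nonempty interior) and pointed (containing no line). -/
structure IsProperCone {E : Type*} [AddCommGroup E] [Module ℝ E] [TopologicalSpace E]
    (K : Set E) : Prop where
  smul_mem : ∀ c : ℝ, 0 ≤ c → ∀ x ∈ K, c • x ∈ K
  convex : Convex ℝ K
  isClosed : IsClosed K
  solid : (interior K).Nonempty
  pointed : ∀ x ∈ K, -x ∈ K → x = 0

/-- Each matrix of the family `B` maps `K` into `K`. -/
def LeavesInvariant {ι κ : Type*} [Fintype ι] (B : κ → Matrix ι ι ℝ) (K : Set (ι → ℝ)) :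
    Prop :=
  ∀ j, ∀ x ∈ K, (B j).mulVec x ∈ K

/-- The coordinate vectors, in the scaled monomial basis, of the forms of degree `d` that are
sums of squares of polynomials. -/
def sosCone (n d : ℕ) : Set (HomExp n d → ℝ) :=
  {c | IsSumSq (formOfCoords c)}

/-! ### The two lifted matrices of the formula -/

section Lifted

variable {V : Type*} [Fintype V] [DecidableEq V] {n m : ℕ}

/-- The sum over the arcs `(u, v, σ)` of `(e_v e_uᵀ) ⊗ A_σ^{[p]}`. -/
noncomputable def liftedSum (G : Automaton V m) (A : Fin m → Matrix (Fin n) (Fin n) ℝ)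
    (p : ℕ) : Matrix (V × HomExp n p) (V × HomExp n p) ℝ :=
  ∑ e ∈ G.edges, Matrix.single e.2.1 e.1 (1 : ℝ) ⊗ₖ symLift p (A e.2.2)

/-- The sum over the paths `s` of length `k` of `(e_{s(k+1)} e_{s(1)}ᵀ) ⊗ A_s^{[p]}`. -/
noncomputable def liftedPathSum (G : Automaton V m) (A : Fin m → Matrix (Fin n) (Fin n) ℝ)
    (p k : ℕ) : Matrix (V × HomExp n p) (V × HomExp n p) ℝ :=
  ∑ s ∈ G.paths k,
    Matrix.single (s.1 (Fin.last k)) (s.1 0) (1 : ℝ) ⊗ₖ symLift p (wordProd A s.2)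

/-- The defining limit of the constrained `p`-radius exists, and the `p`-radius is given both
by the limit of norms of lifted path sums and by the spectral radius of the lifted sum, for
all choices of the norms `ν` (in the definition of the `p`-radius) and `ν'` (in the limit). -/
def PRadiusFormulas (G : Automaton V m) (A : Fin m → Matrix (Fin n) (Fin n) ℝ) (p : ℕ) :
    Prop :=
  ∀ (ν : Seminorm ℝ (Matrix (Fin n) (Fin n) ℝ))
    (ν' : Seminorm ℝ (Matrix (V × HomExp n p) (V × HomExp n p) ℝ)),
    IsNorm ν → IsNorm ν' →
    Tendsto (pRadiusSeq G A ν p) atTop (𝓝 (constrainedPRadius G A ν p)) ∧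
    (∃ L : ℝ,
      Tendsto (fun k : ℕ => ν' (liftedPathSum G A p k) ^ (1 / ((p : ℝ) * k))) atTop (𝓝 L) ∧
      constrainedPRadius G A ν p =
        1 / realSpectralRadius G.adjacency ^ (1 / (p : ℝ)) * L) ∧
    constrainedPRadius G A ν p =
      1 / realSpectralRadius G.adjacency ^ (1 / (p : ℝ)) *
        realSpectralRadius (liftedSum G A p) ^ (1 / (p : ℝ))

end Lifted

/-! ### Homogeneous functions and seminorms on finite-dimensional spaces -/

/-! The lift is multiplicative, so `liftedPathSum` is the `k`-th power of `liftedSum`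
(`liftedPathSum_eq_pow`), and Gelfand's formula gives the growth rate of its norm. Likewise `|E_k|`
is the sum of the entries of the `k`-th power of the adjacency matrix. It remains to compare a sum
of norms with the norm of a sum.

One direction is the triangle inequality. The other needs the cone: if `f` is positive on `K` minus
the origin and `x₀` is interior to `K`, then `φ M = f (M x₀)` is linear and positive on nonzero
matrices leaving `K` invariant. By compactness `‖M‖ ≤ C φ M` there, so by linearity the sum of the
norms is at most a constant times `φ` of the sum. Since `‖A‖ ^ p` and `‖A^{[p]}‖` are also
comparable, both sequences have the same exponential growth rate (`tendsto_sum_pow_norm`).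

For sums of squares, closedness is the delicate point. A square below a form of degree `2d` has a
root homogeneous of degree `d`, so the cone is the linear image of the positive semidefinite Gram
matrices. The Gram map kills no nonzero such matrix, and this makes the image closed. Powers of
linear forms span, giving solidity; nonnegativity gives pointedness; the lift acts on forms by
substitution, which preserves sums of squares. -/

theorem Seminorm.map_smul_of_nonneg {E : Type*} [AddCommGroup E] [Module ℝ E]
    (ν : Seminorm ℝ E) (c : ℝ) (hc : 0 ≤ c) (x : E) :
    ν (c • x) = c * ν x := by
  rw [map_smul_eq_mul, Real.norm_of_nonneg hc]

theorem IsNorm.pos {E : Type*} [AddCommGroup E] [Module ℝ E] {ν : Seminorm ℝ E}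
    (hν : IsNorm ν) {x : E} (hx : x ≠ 0) : 0 < ν x :=
  lt_of_le_of_ne (apply_nonneg ν x) fun h => hx (hν x h.symm)

theorem IsProperCone.zero_mem {E : Type*} [AddCommGroup E] [Module ℝ E] [TopologicalSpace E]
    {K : Set E} (hK : IsProperCone K) : (0 : E) ∈ K := by
  obtain ⟨x, hx⟩ := hK.solid
  simpa using hK.smul_mem 0 le_rfl x (interior_subset hx)

/-- Pointedness puts `-x` outside `K`; a functional separating `-x` from `K` must be nonnegative on
the whole cone. -/
theorem IsProperCone.exists_nonneg_functional_pos {E : Type*} [NormedAddCommGroup E]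
    [NormedSpace ℝ E] {K : Set E} (hK : IsProperCone K) {x : E} (hx : x ∈ K) (hx0 : x ≠ 0) :
    ∃ f : E →L[ℝ] ℝ, (∀ y ∈ K, 0 ≤ f y) ∧ 0 < f x := by
  obtain ⟨f, u, hu, hf⟩ := geometric_hahn_banach_point_closed hK.convex hK.isClosed
    (fun h => hx0 (hK.pointed x hx h))
  have hu0 : u < 0 := by simpa using hf 0 hK.zero_mem
  rw [map_neg] at hu
  refine ⟨f, fun y hy => ?_, by linarith⟩
  by_contra! hneg
  -- Scaling `y` by `u / f y` makes the value of `f` exactly `u`, which strict separation forbids on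
  -- `K`.
  have h := hf _ (hK.smul_mem (u / f y) (div_nonneg_of_nonpos hu0.le hneg.le) y hy)
  rw [map_smul, smul_eq_mul, div_mul_cancel₀ _ hneg.ne] at h
  exact lt_irrefl _ h

section FiniteDimensional

variable {E : Type*} [NormedAddCommGroup E] [NormedSpace ℝ E] [FiniteDimensional ℝ E]

/-- `f / g` is constant along rays and continuous on the compact slice of `S` by the unit sphere,
hence bounded there. Every comparison of norms, lifts and functionals below is an instance. -/
theorem exists_le_mul_of_homogeneous {S : Set E} (hS : IsClosed S)
    (hcone : ∀ c : ℝ, 0 ≤ c → ∀ x ∈ S, c • x ∈ S) {f g : E → ℝ} {p : ℕ} (hp : p ≠ 0)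
    (hf : Continuous f) (hg : Continuous g)
    (hf' : ∀ c : ℝ, 0 ≤ c → ∀ x, f (c • x) = c ^ p * f x)
    (hg' : ∀ c : ℝ, 0 ≤ c → ∀ x, g (c • x) = c ^ p * g x)
    (hpos : ∀ x ∈ S, x ≠ 0 → 0 < g x) :
    ∃ C : ℝ, 0 < C ∧ ∀ x ∈ S, f x ≤ C * g x := by
  have hproper : ProperSpace E := FiniteDimensional.proper ℝ E
  have hne : ∀ x ∈ S ∩ Metric.sphere (0 : E) 1, x ≠ 0 := by
    rintro x ⟨-, hx⟩ rfl
    simp at hx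
  have hcomp : IsCompact (S ∩ Metric.sphere (0 : E) 1) := (isCompact_sphere 0 1).inter_left hS
  have hcont : ContinuousOn (fun x => f x / g x) (S ∩ Metric.sphere (0 : E) 1) :=
    hf.continuousOn.div hg.continuousOn fun x hx => (hpos x hx.1 (hne x hx)).ne'
  obtain ⟨C, hC⟩ := hcomp.bddAbove_image hcont
  -- The maximum with 1 keeps the constant positive, whatever bound the slice provides.
  refine ⟨max C 1, by positivity, fun x hx => ?_⟩
  rcases eq_or_ne x 0 with rfl | hx0
  · have h1 := hf' 0 le_rfl 0
    have h2 := hg' 0 le_rfl 0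
    simp [hp] at h1 h2
    simp [h1, h2]
  have hn : 0 < ‖x‖ := norm_pos_iff.2 hx0
  set y := ‖x‖⁻¹ • x with hy
  have hyS : y ∈ S ∩ Metric.sphere (0 : E) 1 := by
    refine ⟨hcone _ (by positivity) x hx, ?_⟩
    simp [hy, norm_smul, hn.ne']
  have hxy : x = ‖x‖ • y := by simp [hy, smul_smul, hn.ne']
  have hgy := hpos y hyS.1 (hne y hyS)
  have h1 : f y / g y ≤ max C 1 := (hC ⟨y, hyS, rfl⟩).trans (le_max_left _ _)
  rw [div_le_iff₀ hgy] at h1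
  rw [hxy, hf' _ hn.le, hg' _ hn.le, mul_left_comm]
  gcongr

theorem Seminorm.continuous_of_finiteDimensional (ν : Seminorm ℝ E) : Continuous ν :=
  continuousOn_univ.1 (ν.convexOn.continuousOn isOpen_univ)

theorem IsNorm.exists_le_mul {ν : Seminorm ℝ E} (hν : IsNorm ν) (μ : Seminorm ℝ E) :
    ∃ C : ℝ, 0 < C ∧ ∀ x, μ x ≤ C * ν x := by
  obtain ⟨C, hC, h⟩ := exists_le_mul_of_homogeneous (S := (Set.univ : Set E)) isClosed_univ
    (fun _ _ _ _ => trivial) one_ne_zero μ.continuous_of_finiteDimensional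
    ν.continuous_of_finiteDimensional
    (by simpa using μ.map_smul_of_nonneg) (by simpa using ν.map_smul_of_nonneg)
    (fun x _ hx => hν.pos hx)
  exact ⟨C, hC, fun x => h x trivial⟩

theorem IsNorm.exists_linearMap_le_mul {ν : Seminorm ℝ E} (hν : IsNorm ν) (φ : E →ₗ[ℝ] ℝ) :
    ∃ C : ℝ, 0 < C ∧ ∀ x, φ x ≤ C * ν x := by
  obtain ⟨C, hC, h⟩ := exists_le_mul_of_homogeneous (S := (Set.univ : Set E)) isClosed_univ
    (fun _ _ _ _ => trivial) one_ne_zero φ.continuous_of_finiteDimensional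
    ν.continuous_of_finiteDimensional
    (by simp) (by simpa using ν.map_smul_of_nonneg)
    (fun x _ hx => hν.pos hx)
  exact ⟨C, hC, fun x => h x trivial⟩

/-! ### Proper cones -/

/-- A functional positive at one point of the slice stays positive nearby; by compactness finitely
many of them suffice, and their sum is positive on the whole slice. -/
theorem IsProperCone.exists_pos_functional {K : Set E} (hK : IsProperCone K) :
    ∃ f : E →L[ℝ] ℝ, ∀ x ∈ K, x ≠ 0 → 0 < f x := by
  have hproper : ProperSpace E := FiniteDimensional.proper ℝ E
  have hcomp : IsCompact (K ∩ Metric.sphere (0 : E) 1) :=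
    (isCompact_sphere 0 1).inter_left hK.isClosed
  obtain ⟨f, -, hf⟩ := hcomp.induction_on
    (p := fun s => ∃ f : E →L[ℝ] ℝ, (∀ y ∈ K, 0 ≤ f y) ∧ ∀ y ∈ s, y ∈ K → 0 < f y)
    ⟨0, by simp⟩
    (fun s t hst ⟨f, h1, h2⟩ => ⟨f, h1, fun y hy => h2 y (hst hy)⟩)
    (fun s t ⟨f, h1, h2⟩ ⟨g, h3, h4⟩ => ⟨f + g, fun y hy => add_nonneg (h1 y hy) (h3 y hy), by
      rintro y (hy | hy) hyK
      · exact add_pos_of_pos_of_nonneg (h2 y hy hyK) (h3 y hyK)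
      · exact add_pos_of_nonneg_of_pos (h1 y hyK) (h4 y hy hyK)⟩)
    (fun x hx => by
      obtain ⟨f, h1, h2⟩ := hK.exists_nonneg_functional_pos hx.1 (by
        rintro rfl
        simpa using hx.2)
      exact ⟨{y | 0 < f y}, mem_nhdsWithin_of_mem_nhds
        ((isOpen_lt continuous_const f.continuous).mem_nhds h2), f, h1, fun y hy _ => hy⟩)
  refine ⟨f, fun x hx hx0 => ?_⟩
  have hn : 0 < ‖x‖ := norm_pos_iff.2 hx0
  have hxK := hK.smul_mem ‖x‖⁻¹ (by positivity) x hx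
  have h := hf (‖x‖⁻¹ • x) ⟨hxK, by simp [norm_smul, hn.ne']⟩ hxK
  rw [map_smul, smul_eq_mul] at h
  exact pos_of_mul_pos_right h (by positivity)

end FiniteDimensional

/-- A functional that is positive on the nonzero matrices leaving a proper cone invariant. -/
theorem IsProperCone.exists_pos_matrix_functional {ι : Type*} [Fintype ι] {K : Set (ι → ℝ)}
    (hK : IsProperCone K) :
    ∃ φ : Matrix ι ι ℝ →ₗ[ℝ] ℝ, ∀ M : Matrix ι ι ℝ, (∀ x ∈ K, M.mulVec x ∈ K) → M ≠ 0 →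
      0 < φ M := by
  classical
  obtain ⟨f, hf⟩ := hK.exists_pos_functional
  obtain ⟨x₀, hx₀⟩ := hK.solid
  refine ⟨f.toLinearMap ∘ₗ (LinearMap.applyₗ x₀) ∘ₗ Matrix.toLin'.toLinearMap,
    fun M hM hM0 => ?_⟩
  refine hf _ (hM x₀ (interior_subset hx₀)) fun h0 => hM0 ?_
  refine Matrix.toLin'.injective (LinearMap.ext fun y => ?_)
  rw [Matrix.toLin'_apply, map_zero, LinearMap.zero_apply]
  have h0 : M.mulVec x₀ = 0 := h0
  -- Since `x₀` is interior and `M x₀ = 0`, the vector `t • M y = M (x₀ + t • y)` lies in `K` for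
  -- small `t > 0`. So `M` maps every vector into `K`, and pointedness forces `M = 0`.
  have hev : ∀ y : ι → ℝ, ∀ᶠ t : ℝ in 𝓝[>] 0, x₀ + t • y ∈ K := by
    intro y
    have hc : Tendsto (fun t : ℝ => x₀ + t • y) (𝓝[>] 0) (𝓝 x₀) := by
      have : Continuous fun t : ℝ => x₀ + t • y := by fun_prop
      exact (by simpa using this.tendsto 0 : Tendsto _ (𝓝 (0 : ℝ)) (𝓝 x₀)).mono_left
        nhdsWithin_le_nhds
    filter_upwards [hc.eventually (mem_interior_iff_mem_nhds.1 hx₀)] with t ht using ht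
  have key : ∀ y : ι → ℝ, M.mulVec y ∈ K := by
    intro y
    obtain ⟨t, ht, ht0⟩ := ((hev y).and self_mem_nhdsWithin).exists
    have h1 := hM _ ht
    have ht0 : 0 < t := ht0
    rw [Matrix.mulVec_add, h0, zero_add, Matrix.mulVec_smul] at h1
    simpa [smul_smul, ht0.ne'] using hK.smul_mem t⁻¹ (by positivity) _ h1
  refine hK.pointed _ (key y) ?_
  rw [← Matrix.mulVec_neg]
  exact key _

/-! ### Growth rates -/

theorem tendsto_const_rpow_one_div {C : ℝ} (hC : 0 < C) :
    Tendsto (fun k : ℕ => C ^ (1 / (k : ℝ))) atTop (𝓝 1) := by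
  have h := (tendsto_const_nhds (x := C)).rpow tendsto_one_div_atTop_nhds_zero_nat
    (Or.inl hC.ne')
  simpa using h

/-- Constant factors disappear in the limit because their `k`-th roots tend to 1. -/
theorem tendsto_rpow_one_div_of_comparable {a b : ℕ → ℝ} (ha : ∀ k, 0 ≤ a k) (hb : ∀ k, 0 ≤ b k)
    {C D L : ℝ} (hC : 0 < C) (hD : 0 < D) (hab : ∀ k, a k ≤ C * b k) (hba : ∀ k, b k ≤ D * a k)
    (hL : Tendsto (fun k : ℕ => b k ^ (1 / (k : ℝ))) atTop (𝓝 L)) :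
    Tendsto (fun k : ℕ => a k ^ (1 / (k : ℝ))) atTop (𝓝 L) := by
  have h1 : Tendsto (fun k : ℕ => (D⁻¹) ^ (1 / (k : ℝ)) * b k ^ (1 / (k : ℝ))) atTop (𝓝 L) := by
    simpa using (tendsto_const_rpow_one_div (inv_pos.2 hD)).mul hL
  have h2 : Tendsto (fun k : ℕ => C ^ (1 / (k : ℝ)) * b k ^ (1 / (k : ℝ))) atTop (𝓝 L) := by
    simpa using (tendsto_const_rpow_one_div hC).mul hL
  refine tendsto_of_tendsto_of_tendsto_of_le_of_le h1 h2 (fun k => ?_) (fun k => ?_)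
  · have hDb : 0 ≤ D⁻¹ * b k := mul_nonneg (by positivity) (hb k)
    simp only
    rw [← Real.mul_rpow (by positivity) (hb k)]
    refine Real.rpow_le_rpow hDb ?_ (by positivity)
    rw [inv_mul_le_iff₀ hD]
    exact hba k
  · simp only
    rw [← Real.mul_rpow hC.le (hb k)]
    exact Real.rpow_le_rpow (ha k) (hab k) (by positivity)

/-! ### Gelfand's formula for real matrices. -/

section Gelfand

attribute [local instance] Matrix.linftyOpNormedRing Matrix.linftyOpNormedAlgebra

/-- The `L^∞` operator norm of the complexification of a real matrix. -/
noncomputable def complexLinftySeminorm (ι : Type*) [Fintype ι] [DecidableEq ι] :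
    Seminorm ℝ (Matrix ι ι ℝ) :=
  Seminorm.of (fun M => ‖M.map (algebraMap ℝ ℂ)‖)
    (fun M N => by
      rw [Matrix.map_add _ (map_add (algebraMap ℝ ℂ))]
      exact norm_add_le _ _)
    (fun c M => by
      have h : (c • M).map (algebraMap ℝ ℂ) = (c : ℂ) • M.map (algebraMap ℝ ℂ) := by
        ext i j
        simp
      rw [h, norm_smul]
      simp)

theorem isNorm_complexLinftySeminorm (ι : Type*) [Fintype ι] [DecidableEq ι] :
    IsNorm (complexLinftySeminorm ι) := by
  intro M hM
  have h : M.map (algebraMap ℝ ℂ) = 0 := norm_eq_zero.1 hM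
  ext i j
  simpa using congrFun (congrFun h i) j

theorem tendsto_complexLinftySeminorm_pow {ι : Type*} [Fintype ι] [DecidableEq ι]
    (M : Matrix ι ι ℝ) :
    Tendsto (fun k : ℕ => complexLinftySeminorm ι (M ^ k) ^ (1 / (k : ℝ))) atTop
      (𝓝 (realSpectralRadius M)) := by
  -- Finiteness is needed because `toReal` is continuous only away from `⊤`.
  have hfin : spectralRadius ℂ (M.map (algebraMap ℝ ℂ)) ≠ ⊤ := by
    refine ne_top_of_le_ne_top ?_ (spectrum.spectralRadius_le_pow_nnnorm_pow_one_div ℂ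
      (M.map (algebraMap ℝ ℂ)) 0)
    simp [ENNReal.mul_eq_top]
  have h := (ENNReal.tendsto_toReal hfin).comp
    (spectrum.pow_norm_pow_one_div_tendsto_nhds_spectralRadius (M.map (algebraMap ℝ ℂ)))
  refine h.congr fun k => ?_
  have hpow : (M ^ k).map (algebraMap ℝ ℂ) = M.map (algebraMap ℝ ℂ) ^ k :=
    map_pow (algebraMap ℝ ℂ).mapMatrix M k
  change (ENNReal.ofReal _).toReal = ‖(M ^ k).map (algebraMap ℝ ℂ)‖ ^ (1 / (k : ℝ))
  rw [hpow, ENNReal.toReal_ofReal (by positivity)]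

end Gelfand

section

attribute [local instance] Matrix.normedAddCommGroup Matrix.normedSpace

/-- Gelfand's formula for a real matrix and an arbitrary norm. -/
theorem IsNorm.tendsto_pow_rpow_one_div {ι : Type*} [Fintype ι] [DecidableEq ι]
    {ν : Seminorm ℝ (Matrix ι ι ℝ)} (hν : IsNorm ν) (M : Matrix ι ι ℝ) :
    Tendsto (fun k : ℕ => ν (M ^ k) ^ (1 / (k : ℝ))) atTop (𝓝 (realSpectralRadius M)) := by
  obtain ⟨C, hC, h1⟩ := (isNorm_complexLinftySeminorm ι).exists_le_mul ν
  obtain ⟨D, hD, h2⟩ := hν.exists_le_mul (complexLinftySeminorm ι)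
  exact tendsto_rpow_one_div_of_comparable (fun k => apply_nonneg ν _)
    (fun k => apply_nonneg (complexLinftySeminorm ι) _) hC hD (fun k => h1 _) (fun k => h2 _)
    (tendsto_complexLinftySeminorm_pow M)

/-- The matrices leaving `K` invariant form a closed cone on which `φ` is positive away from 0. As
`φ` is linear, this reverses the triangle inequality up to a constant. -/
theorem IsProperCone.exists_le_mul_matrix_functional {ι : Type*} [Fintype ι] {K : Set (ι → ℝ)}
    (hK : IsProperCone K) {μ : Matrix ι ι ℝ → ℝ} (hμ : Continuous μ)
    (hμ' : ∀ c : ℝ, 0 ≤ c → ∀ M, μ (c • M) = c * μ M) :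
    ∃ φ : Matrix ι ι ℝ →ₗ[ℝ] ℝ, ∃ C : ℝ, 0 < C ∧
      ∀ M : Matrix ι ι ℝ, (∀ x ∈ K, M.mulVec x ∈ K) → μ M ≤ C * φ M := by
  obtain ⟨φ, hφ⟩ := hK.exists_pos_matrix_functional
  have hcl : IsClosed {M : Matrix ι ι ℝ | ∀ x ∈ K, M.mulVec x ∈ K} := by
    simp only [Set.ofPred_forall]
    exact isClosed_biInter fun x _ => hK.isClosed.preimage
      (Continuous.matrix_mulVec continuous_id continuous_const)
  obtain ⟨C, hC, h⟩ := exists_le_mul_of_homogeneous hcl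
    (fun c hc M hM x hx => by
      rw [Matrix.smul_mulVec]
      exact hK.smul_mem c hc _ (hM x hx)) one_ne_zero hμ φ.continuous_of_finiteDimensional
    (by simpa using hμ') (by simp) (fun M hM => hφ M hM)
  exact ⟨φ, C, hC, h⟩

end

/-! ### Sums over paths as matrix powers -/

theorem Automaton.exists_edge_to {V : Type*} {m : ℕ} (G : Automaton V m)
    (hG : G.StronglyConnected) (hE : G.edges.Nonempty) (v : V) : ∃ u σ, (u, v, σ) ∈ G.edges := by
  obtain ⟨⟨a, b, σ⟩, he⟩ := hE
  rcases (Relation.ReflTransGen.cases_tail (hG b v)) with h | ⟨c, -, τ, hτ⟩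
  · subst h
    exact ⟨a, σ, he⟩
  · exact ⟨c, τ, hτ⟩

theorem Automaton.transpose_adjacency {V : Type*} [DecidableEq V] {m : ℕ} (G : Automaton V m) :
    G.adjacency.transpose = ∑ e ∈ G.edges, Matrix.single e.2.1 e.1 (1 : ℝ) := by
  ext v u
  rw [Matrix.sum_apply]
  simp only [Matrix.transpose_apply, Automaton.adjacency, Matrix.of_apply, Matrix.single_apply,
    Finset.sum_boole]
  congr 1
  refine Finset.card_nbij' (fun σ => (u, v, σ)) (fun e => e.2.2) ?_ ?_ ?_ ?_
  · intro σ hσ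
    simpa using hσ
  · rintro ⟨a, b, σ⟩ h
    simp only [Finset.coe_filter, Set.mem_ofPred_eq] at h
    obtain ⟨h, rfl, rfl⟩ := h
    simpa using h
  · intro σ _
    rfl
  · rintro ⟨a, b, σ⟩ h
    simp only [Finset.coe_filter, Set.mem_ofPred_eq] at h
    obtain ⟨h, rfl, rfl⟩ := h
    rfl

section Paths

variable {V : Type*} [Fintype V] [DecidableEq V] {n m : ℕ}

theorem Automaton.mem_paths {G : Automaton V m} {k : ℕ}
    {s : (Fin (k + 1) → V) × (Fin k → Fin m)} :
    s ∈ G.paths k ↔ ∀ i : Fin k, (s.1 i.castSucc, s.1 i.succ, s.2 i) ∈ G.edges := by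
  simp [Automaton.paths]

theorem Automaton.cons_mem_paths {G : Automaton V m} {k : ℕ}
    {s : (Fin (k + 1) → V) × (Fin k → Fin m)} (hs : s ∈ G.paths k) {u : V} {σ : Fin m}
    (he : (u, s.1 0, σ) ∈ G.edges) :
    ((Fin.cons u s.1 : Fin (k + 2) → V), (Fin.cons σ s.2 : Fin (k + 1) → Fin m)) ∈
      G.paths (k + 1) := by
  rw [Automaton.mem_paths] at hs ⊢
  intro i
  refine Fin.cases ?_ (fun j => ?_) i
  · simpa using he
  · simpa [← Fin.succ_castSucc] using hs j

/-- In the expanded power, a product of matrix units survives only if consecutive arcs meet, so the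
terms are indexed by paths. The coefficient 1 counts paths; lifted matrices as coefficients give the
lifted sum. -/
theorem Automaton.sum_paths_single {R : Type*} [Semiring R] (G : Automaton V m) (f : Fin m → R)
    (k : ℕ) :
    ∑ s ∈ G.paths k, Matrix.single (s.1 (Fin.last k)) (s.1 0)
        (List.ofFn fun i => f (s.2 i)).reverse.prod =
      (∑ e ∈ G.edges, Matrix.single e.2.1 e.1 (f e.2.2)) ^ k := by
  induction k with
  | zero =>
    have h : G.paths 0 = Finset.univ := by
      ext s
      simp [Automaton.mem_paths]
    rw [h, Fintype.sum_prod_type]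
    simp only [Finset.univ_unique, List.ofFn_zero, List.reverse_nil, List.prod_nil,
      Finset.sum_singleton, pow_zero]
    rw [← Matrix.sum_single_one]
    exact Fintype.sum_equiv (Equiv.funUnique (Fin 1) V) _ _ fun v => rfl
  | succ k ih =>
    -- The factor split off on the right is the arc traversed first, so paths grow at their start.
    rw [pow_succ, ← ih, Finset.sum_mul_sum, ← Finset.sum_product']
    rw [← Finset.sum_filter_add_sum_filter_not (G.paths k ×ˢ G.edges)
      (fun q => q.1.1 0 = q.2.2.1)]
    have hz : ∑ q ∈ (G.paths k ×ˢ G.edges).filter (fun q => ¬ q.1.1 0 = q.2.2.1),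
        Matrix.single (q.1.1 (Fin.last k)) (q.1.1 0) (List.ofFn fun i => f (q.1.2 i)).reverse.prod *
          Matrix.single q.2.2.1 q.2.1 (f q.2.2.2) = 0 :=
      Finset.sum_eq_zero fun q hq =>
        Matrix.single_mul_single_of_ne _ _ _ _ (Finset.mem_filter.1 hq).2 _
    rw [hz, add_zero]
    refine (Finset.sum_nbij'
      (fun q => ((Fin.cons q.2.1 q.1.1 : Fin (k + 2) → V),
        (Fin.cons q.2.2.2 q.1.2 : Fin (k + 1) → Fin m)))
      (fun t => ((Fin.tail t.1, Fin.tail t.2), (t.1 0, t.1 1, t.2 0))) ?_ ?_ ?_ ?_ ?_).symm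
    · rintro ⟨s, u, v, σ⟩ hq
      simp only [Finset.mem_filter, Finset.mem_product] at hq
      obtain ⟨⟨hs, he⟩, rfl⟩ := hq
      exact Automaton.cons_mem_paths hs he
    · rintro ⟨x, w⟩ ht
      rw [Automaton.mem_paths] at ht
      simp only [Finset.mem_filter, Finset.mem_product]
      refine ⟨⟨?_, by simpa using ht 0⟩, rfl⟩
      rw [Automaton.mem_paths]
      intro i
      simpa [Fin.tail] using ht i.succ
    · rintro ⟨⟨x, w⟩, u, v, σ⟩ hq
      simp only [Finset.mem_filter, Finset.mem_product] at hq
      obtain ⟨-, rfl⟩ := hq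
      rfl
    · rintro ⟨x, w⟩ -
      simp [Fin.cons_self_tail]
    · rintro ⟨⟨x, w⟩, u, v, σ⟩ hq
      simp only [Finset.mem_filter, Finset.mem_product] at hq
      obtain ⟨-, rfl⟩ := hq
      simp [Matrix.single_mul_single_same, List.ofFn_succ, ← Fin.succ_last]

theorem Automaton.adjacency_pow_apply (G : Automaton V m) (k : ℕ) (u v : V) :
    (G.adjacency ^ k) u v = ∑ s ∈ G.paths k,
      if s.1 (Fin.last k) = v ∧ s.1 0 = u then (1 : ℝ) else 0 := by
  have h := G.sum_paths_single (fun _ => (1 : ℝ)) k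
  rw [← Automaton.transpose_adjacency, ← Matrix.transpose_pow] at h
  rw [← Matrix.transpose_apply (G.adjacency ^ k), ← h, Matrix.sum_apply]
  refine Finset.sum_congr rfl fun s _ => ?_
  simp [Matrix.single_apply]

theorem Automaton.sum_adjacency_pow_apply (G : Automaton V m) (k : ℕ) :
    ∑ u, ∑ v, (G.adjacency ^ k) u v = (G.paths k).card := by
  have h : ∀ u, ∑ v, ∑ s ∈ G.paths k,
      (if s.1 (Fin.last k) = v ∧ s.1 0 = u then (1 : ℝ) else 0) =
      ∑ s ∈ G.paths k, if s.1 0 = u then (1 : ℝ) else 0 := by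
    intro u
    rw [Finset.sum_comm]
    refine Finset.sum_congr rfl fun s _ => ?_
    simp [ite_and]
  simp only [Automaton.adjacency_pow_apply, h]
  rw [Finset.sum_comm]
  simp

theorem Automaton.paths_nonempty (G : Automaton V m) (hG : G.StronglyConnected)
    (hE : G.edges.Nonempty) (k : ℕ) : (G.paths k).Nonempty := by
  induction k with
  | zero =>
    obtain ⟨e, -⟩ := hE
    exact ⟨(fun _ => e.1, Fin.elim0), Automaton.mem_paths.2 fun i => i.elim0⟩
  | succ k ih =>
    obtain ⟨s, hs⟩ := ih
    obtain ⟨u, σ, he⟩ := G.exists_edge_to hG hE (s.1 0)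
    exact ⟨_, Automaton.cons_mem_paths hs he⟩

end Paths

/-! ### Algebra of the symmetric lift -/

section SymLift

variable {n d : ℕ}

theorem symLift_mul (A B : Matrix (Fin n) (Fin n) ℝ) :
    symLift d (A * B) = symLift d A * symLift d B := by
  refine ((existsUnique_symLift _ _).1 fun x => ?_).symm
  rw [← Matrix.mulVec_mulVec, symLift_mulVec, symLift_mulVec, Matrix.mulVec_mulVec]

theorem symLift_one : symLift d (1 : Matrix (Fin n) (Fin n) ℝ) = 1 :=
  ((existsUnique_symLift _ _).1 fun x => by simp).symm

theorem symLift_wordProd {m k : ℕ} (A : Fin m → Matrix (Fin n) (Fin n) ℝ) (w : Fin k → Fin m) :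
    symLift d (wordProd A w) = (List.ofFn fun i => symLift d (A (w i))).reverse.prod := by
  have h := map_list_prod (⟨⟨symLift d, symLift_one⟩, symLift_mul⟩ :
    Matrix (Fin n) (Fin n) ℝ →* Matrix (HomExp n d) (HomExp n d) ℝ)
    (List.ofFn fun i => A (w i)).reverse
  rw [List.map_reverse, List.map_ofFn] at h
  exact h

theorem sum_homExp (α : HomExp n d) : ∑ i, α.1 i = d := by
  simpa using (Finset.mem_finsuppAntidiag.1 α.2).1

theorem scaledMonomials_smul (c : ℝ) (x : Fin n → ℝ) :
    scaledMonomials d (c • x) = c ^ d • scaledMonomials d x := by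
  funext α
  simp only [scaledMonomials, Pi.smul_apply, smul_eq_mul, mul_pow, Finset.prod_mul_distrib,
    Finset.prod_pow_eq_pow_sum, sum_homExp α]
  ring

theorem symLift_smul (c : ℝ) (A : Matrix (Fin n) (Fin n) ℝ) :
    symLift d (c • A) = c ^ d • symLift d A := by
  refine ((existsUnique_symLift _ _).1 fun x => ?_).symm
  rw [Matrix.smul_mulVec, Matrix.smul_mulVec, symLift_mulVec, scaledMonomials_smul]

theorem sum_multinomial_mul_prod_pow (z : Fin n → ℝ) :
    ∑ α : HomExp n d, (Nat.multinomial Finset.univ α.1 : ℝ) * ∏ i, z i ^ α.1 i =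
      (∑ i, z i) ^ d := by
  rw [Finset.sum_pow_eq_sum_piAntidiag]
  rw [Finset.sum_coe_sort (Finset.finsuppAntidiag (Finset.univ : Finset (Fin n)) d)
    (fun α : Fin n →₀ ℕ => (Nat.multinomial Finset.univ α : ℝ) * ∏ i, z i ^ α i)]
  refine Finset.sum_nbij' (fun α => (α : Fin n → ℕ)) (fun f => Finsupp.equivFunOnFinite.symm f)
    ?_ ?_ ?_ ?_ ?_
  · intro α hα
    simpa [Finset.mem_finsuppAntidiag, Finset.mem_piAntidiag] using hα
  · intro f hf
    simpa [Finset.mem_finsuppAntidiag, Finset.mem_piAntidiag] using hf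
  · intro α _
    ext i
    simp
  · intro f _
    rfl
  · intro α _
    rfl

/-- The scaling is chosen so that this is the multinomial theorem. -/
theorem scaledMonomials_dotProduct (x y : Fin n → ℝ) :
    scaledMonomials d x ⬝ᵥ scaledMonomials d y = (x ⬝ᵥ y) ^ d := by
  rw [dotProduct, dotProduct, ← sum_multinomial_mul_prod_pow]
  refine Finset.sum_congr rfl fun α _ => ?_
  have h : scaling α * scaling α = Nat.multinomial Finset.univ α.1 :=
    Real.mul_self_sqrt (Nat.cast_nonneg _)
  simp only [scaledMonomials, mul_pow, Finset.prod_mul_distrib]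
  rw [← h]
  ring

theorem formOfCoords_eq_zero {c : HomExp n d → ℝ} (h : formOfCoords c = 0) : c = 0 := by
  funext α
  have h1 := coeff_formOfCoords c α
  rw [h, MvPolynomial.coeff_zero] at h1
  exact (mul_eq_zero.1 h1.symm).resolve_right (scaling_pos α).ne'

theorem eq_zero_of_dotProduct_scaledMonomials {c : HomExp n d → ℝ}
    (h : ∀ x, c ⬝ᵥ scaledMonomials d x = 0) : c = 0 :=
  formOfCoords_eq_zero (MvPolynomial.funext fun x => by rw [eval_formOfCoords, h, map_zero])

/-- Both sides, applied to `x^{[d]}` and paired with `y^{[d]}`, give `(x ⬝ᵥ A y) ^ d`, and such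
pairings determine a vector. -/
theorem symLift_transpose (A : Matrix (Fin n) (Fin n) ℝ) :
    symLift d A.transpose = (symLift d A).transpose := by
  refine ((existsUnique_symLift _ _).1 fun x => ?_).symm
  rw [← sub_eq_zero]
  refine eq_zero_of_dotProduct_scaledMonomials fun y => ?_
  rw [sub_dotProduct, scaledMonomials_dotProduct, sub_eq_zero, Matrix.mulVec_transpose,
    Matrix.mulVec_transpose, ← Matrix.dotProduct_mulVec, ← Matrix.dotProduct_mulVec,
    symLift_mulVec, scaledMonomials_dotProduct]

/-- If the lift vanishes, then `(A x ⬝ᵥ A x) ^ d = 0` for every `x`. -/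
theorem eq_zero_of_symLift_eq_zero (hd : d ≠ 0) {A : Matrix (Fin n) (Fin n) ℝ}
    (h : symLift d A = 0) : A = 0 := by
  refine Matrix.toLin'.injective (LinearMap.ext fun x => ?_)
  have h1 := scaledMonomials_dotProduct (d := d) (A.mulVec x) (A.mulVec x)
  rw [← symLift_mulVec, h, Matrix.zero_mulVec, zero_dotProduct] at h1
  simpa using dotProduct_self_eq_zero.1 (pow_eq_zero_iff hd |>.1 h1.symm)

theorem continuous_coeff_mul {X : Type*} [TopologicalSpace X] {f g : X → MvPolynomial (Fin n) ℝ}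
    (hf : ∀ β, Continuous fun x => (f x).coeff β) (hg : ∀ β, Continuous fun x => (g x).coeff β)
    (β : Fin n →₀ ℕ) : Continuous fun x => (f x * g x).coeff β := by
  simp only [MvPolynomial.coeff_mul]
  exact continuous_finsetSum _ fun q _ => (hf _).mul (hg _)

theorem continuous_symLift : Continuous fun A : Matrix (Fin n) (Fin n) ℝ => symLift d A := by
  classical
  have hlin : ∀ (i : Fin n) (β : Fin n →₀ ℕ), Continuous fun A : Matrix (Fin n) (Fin n) ℝ =>
      (∑ j, MvPolynomial.C (A i j) * MvPolynomial.X j : MvPolynomial (Fin n) ℝ).coeff β := by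
    intro i β
    simp only [MvPolynomial.coeff_sum, MvPolynomial.coeff_C_mul]
    exact continuous_finsetSum _ fun j _ => (continuous_id.matrix_elem i j).mul continuous_const
  have hpow : ∀ (i : Fin n) (k : ℕ) (β : Fin n →₀ ℕ),
      Continuous fun A : Matrix (Fin n) (Fin n) ℝ =>
        ((∑ j, MvPolynomial.C (A i j) * MvPolynomial.X j : MvPolynomial (Fin n) ℝ) ^ k).coeff β := by
    intro i k
    induction k with
    | zero => simpa using fun β => continuous_const
    | succ k ih =>
      simp only [pow_succ]
      exact continuous_coeff_mul ih (hlin i)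
  have hprod : ∀ (α : Fin n →₀ ℕ) (s : Finset (Fin n)) (β : Fin n →₀ ℕ),
      Continuous fun A : Matrix (Fin n) (Fin n) ℝ => (∏ i ∈ s,
        (∑ j, MvPolynomial.C (A i j) * MvPolynomial.X j : MvPolynomial (Fin n) ℝ) ^ α i).coeff β := by
    intro α s
    induction s using Finset.induction_on with
    | empty => simpa using fun β => continuous_const
    | insert i s hi ih =>
      simp only [Finset.prod_insert hi]
      exact continuous_coeff_mul (hpow i _) ih
  refine continuous_matrix fun α β => ?_
  simp only [symLift, Matrix.of_apply]
  exact continuous_const.mul (hprod α.1 Finset.univ β.1)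

end SymLift

/-! ### The lifted matrices -/

section Lifted

variable {V : Type*} [Fintype V] [DecidableEq V] {n m : ℕ}

/-- Reading the Kronecker product as a block matrix lets `sum_paths_single` be used with matrix
coefficients. -/
theorem single_kronecker {ι : Type*} [Fintype ι] [DecidableEq ι] (v u : V) (M : Matrix ι ι ℝ) :
    Matrix.single v u (1 : ℝ) ⊗ₖ M =
      Matrix.compRingEquiv V ι ℝ (Matrix.single v u M) := by
  ext ⟨a, i⟩ ⟨b, j⟩
  change Matrix.single v u (1 : ℝ) a b * M i j = Matrix.single v u M a b i j
  by_cases h : v = a ∧ u = b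
  · obtain ⟨rfl, rfl⟩ := h
    simp
  · rw [Matrix.single_apply_of_ne _ _ _ _ _ h, Matrix.single_apply_of_ne _ _ _ _ _ h, zero_mul,
      Matrix.zero_apply]

theorem liftedPathSum_eq_pow (G : Automaton V m) (A : Fin m → Matrix (Fin n) (Fin n) ℝ)
    (p k : ℕ) : liftedPathSum G A p k = liftedSum G A p ^ k := by
  simp only [liftedPathSum, liftedSum, single_kronecker, symLift_wordProd]
  rw [← map_sum, ← map_sum, ← map_pow, ← G.sum_paths_single (fun σ => symLift p (A σ)) k]

end Lifted

/-! ### The formulas for the constrained `p`-radius under an invariant cone -/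

/-- The sum of the absolute values of the entries. -/
noncomputable def entrySumSeminorm (ι : Type*) [Fintype ι] : Seminorm ℝ (Matrix ι ι ℝ) :=
  Seminorm.of (fun M => ∑ i, ∑ j, |M i j|)
    (fun M N => by
      simp only [← Finset.sum_add_distrib]
      exact Finset.sum_le_sum fun i _ => Finset.sum_le_sum fun j _ => abs_add_le _ _)
    (fun c M => by simp [abs_mul, Finset.mul_sum])

theorem isNorm_entrySumSeminorm (ι : Type*) [Fintype ι] : IsNorm (entrySumSeminorm ι) := by
  intro M hM
  have hM : ∑ i, ∑ j, |M i j| = 0 := hM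
  ext i j
  rw [Finset.sum_eq_zero_iff_of_nonneg
    (fun i _ => Finset.sum_nonneg fun j _ => abs_nonneg _)] at hM
  have h := hM i (Finset.mem_univ _)
  rw [Finset.sum_eq_zero_iff_of_nonneg (fun j _ => abs_nonneg _)] at h
  simpa using h j (Finset.mem_univ _)

section Main

variable {V : Type*} [Fintype V] [DecidableEq V] {n m : ℕ}

theorem Automaton.tendsto_card_paths (G : Automaton V m) :
    Tendsto (fun k : ℕ => ((G.paths k).card : ℝ) ^ (1 / (k : ℝ))) atTop
      (𝓝 (realSpectralRadius G.adjacency)) := by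
  refine ((isNorm_entrySumSeminorm V).tendsto_pow_rpow_one_div G.adjacency).congr fun k => ?_
  rw [← G.sum_adjacency_pow_apply k]
  congr 1
  change ∑ u, ∑ v, |(G.adjacency ^ k) u v| = _
  refine Finset.sum_congr rfl fun u _ => Finset.sum_congr rfl fun v _ => abs_of_nonneg ?_
  rw [Automaton.adjacency_pow_apply]
  exact Finset.sum_nonneg fun s _ => by positivity

theorem Automaton.realSpectralRadius_adjacency_pos (G : Automaton V m)
    (hG : G.StronglyConnected) (hE : G.edges.Nonempty) :
    0 < realSpectralRadius G.adjacency := by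
  refine one_pos.trans_le (ge_of_tendsto' G.tendsto_card_paths fun k => ?_)
  refine Real.one_le_rpow ?_ (by positivity)
  exact_mod_cast (G.paths_nonempty hG hE k).card_pos

theorem sum_outPowerSum (G : Automaton V m) (A : Fin m → Matrix (Fin n) (Fin n) ℝ)
    (ν : Seminorm ℝ (Matrix (Fin n) (Fin n) ℝ)) (p k : ℕ) :
    ∑ v, outPowerSum G A ν p k v = ∑ s ∈ G.paths k, ν (wordProd A s.2) ^ p := by
  simp only [outPowerSum, Automaton.pathsFrom, Real.rpow_natCast]
  exact Finset.sum_fiberwise _ _ _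

theorem mulVec_list_prod_mem {ι : Type*} [Fintype ι] [DecidableEq ι] {K : Set (ι → ℝ)}
    (l : List (Matrix ι ι ℝ)) (hl : ∀ M ∈ l, ∀ x ∈ K, M.mulVec x ∈ K) :
    ∀ x ∈ K, l.prod.mulVec x ∈ K := by
  induction l with
  | nil => simp
  | cons M l ih =>
    intro x hx
    rw [List.prod_cons, ← Matrix.mulVec_mulVec]
    exact hl M (by simp) _ (ih (fun N hN => hl N (by simp [hN])) x hx)

theorem LeavesInvariant.wordProd {p k : ℕ} {A : Fin m → Matrix (Fin n) (Fin n) ℝ}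
    {K : Set (HomExp n p → ℝ)} (hA : LeavesInvariant (fun σ => symLift p (A σ)) K)
    (w : Fin k → Fin m) : ∀ x ∈ K, (symLift p (wordProd A w)).mulVec x ∈ K := by
  rw [symLift_wordProd]
  refine mulVec_list_prod_mem _ fun M hM => ?_
  obtain ⟨i, rfl⟩ : ∃ i, symLift p (A (w i)) = M := by simpa [List.mem_ofFn] using hM
  exact hA (w i)

/-- The sum of the blocks of a block matrix. -/
def blockSum (V ι : Type*) [Fintype V] : Matrix (V × ι) (V × ι) ℝ →ₗ[ℝ] Matrix ι ι ℝ where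
  toFun N := Matrix.of fun i j => ∑ v, ∑ u, N (v, i) (u, j)
  map_add' M N := by
    ext i j
    simp [Finset.sum_add_distrib]
  map_smul' c M := by
    ext i j
    simp [Finset.mul_sum]

theorem blockSum_single_kronecker {ι : Type*} (v u : V) (M : Matrix ι ι ℝ) :
    blockSum V ι (Matrix.single v u (1 : ℝ) ⊗ₖ M) = M := by
  ext i j
  simp [blockSum, Matrix.single_apply, ite_and]

attribute [local instance] Matrix.normedAddCommGroup Matrix.normedSpace

theorem continuous_kronecker_right {ι : Type*} [Finite ι] {W : Type*} [Finite W]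
    (B : Matrix W W ℝ) : Continuous fun M : Matrix ι ι ℝ => B ⊗ₖ M :=
  continuous_matrix fun a b => continuous_const.mul (continuous_id.matrix_elem a.2 b.2)

theorem exists_pow_norm_le_mul_symLift {p : ℕ} (hp : p ≠ 0)
    (ν : Seminorm ℝ (Matrix (Fin n) (Fin n) ℝ)) :
    ∃ C : ℝ, 0 < C ∧ ∀ M, ν M ^ p ≤ C * ‖symLift p M‖ := by
  obtain ⟨C, hC, h⟩ := exists_le_mul_of_homogeneous
    (S := (Set.univ : Set (Matrix (Fin n) (Fin n) ℝ))) isClosed_univ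
    (fun _ _ _ _ => trivial) hp (ν.continuous_of_finiteDimensional.pow p)
    (continuous_norm.comp (continuous_symLift (d := p)))
    (fun c hc M => by rw [Pi.pow_apply, Pi.pow_apply, ν.map_smul_of_nonneg c hc, mul_pow])
    (fun c hc M => by
      simp only [Function.comp_apply]
      rw [symLift_smul, norm_smul, Real.norm_of_nonneg (by positivity)])
    (fun M _ hM => norm_pos_iff.2 fun h => hM (eq_zero_of_symLift_eq_zero hp h))
  exact ⟨C, hC, fun M => h M trivial⟩

theorem IsNorm.exists_kronecker_symLift_le_mul {p : ℕ} (hp : p ≠ 0)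
    {ν : Seminorm ℝ (Matrix (Fin n) (Fin n) ℝ)} (hν : IsNorm ν)
    (ν' : Seminorm ℝ (Matrix (V × HomExp n p) (V × HomExp n p) ℝ)) :
    ∃ C : ℝ, 0 < C ∧ ∀ v u M,
      ν' (Matrix.single v u (1 : ℝ) ⊗ₖ symLift p M) ≤ C * ν M ^ p := by
  obtain ⟨C, hC, h⟩ := exists_le_mul_of_homogeneous
    (S := (Set.univ : Set (Matrix (Fin n) (Fin n) ℝ))) isClosed_univ
    (fun _ _ _ _ => trivial) hp
    -- Summing over all pairs of nodes yields one constant valid for every block position.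
    (f := fun M => ∑ q : V × V, ν' (Matrix.single q.1 q.2 (1 : ℝ) ⊗ₖ symLift p M))
    (continuous_finsetSum _ fun q _ => ν'.continuous_of_finiteDimensional.comp
      ((continuous_kronecker_right _).comp continuous_symLift))
    (ν.continuous_of_finiteDimensional.pow p)
    (fun c hc M => by
      simp only [symLift_smul, Matrix.kronecker_smul, Finset.mul_sum,
        ν'.map_smul_of_nonneg _ (pow_nonneg hc p)])
    (fun c hc M => by rw [Pi.pow_apply, Pi.pow_apply, ν.map_smul_of_nonneg c hc, mul_pow])
    (fun M _ hM => pow_pos (hν.pos hM) p)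
  refine ⟨C, hC, fun v u M => le_trans ?_ (h M trivial)⟩
  exact Finset.single_le_sum
    (f := fun q : V × V => ν' (Matrix.single q.1 q.2 (1 : ℝ) ⊗ₖ symLift p M))
    (fun q _ => apply_nonneg ν' _) (Finset.mem_univ (v, u))

/-- The block sum of the lifted path sum is the sum of the `A_s^{[p]}`, so `φ` composed with it
bounds the sum of the norms from above by the norm of the power; subadditivity gives the converse
bound. -/
theorem tendsto_sum_pow_norm (G : Automaton V m) (A : Fin m → Matrix (Fin n) (Fin n) ℝ)
    {p : ℕ} (hp : p ≠ 0) {K : Set (HomExp n p → ℝ)} (hK : IsProperCone K)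
    (hA : LeavesInvariant (fun σ => symLift p (A σ)) K)
    {ν : Seminorm ℝ (Matrix (Fin n) (Fin n) ℝ)} (hν : IsNorm ν) :
    Tendsto (fun k : ℕ => (∑ s ∈ G.paths k, ν (wordProd A s.2) ^ p) ^ (1 / (k : ℝ))) atTop
      (𝓝 (realSpectralRadius (liftedSum G A p))) := by
  have hν' := isNorm_entrySumSeminorm (V × HomExp n p)
  set ν' := entrySumSeminorm (V × HomExp n p)
  obtain ⟨C₁, hC₁, h₁⟩ := exists_pow_norm_le_mul_symLift hp ν
  obtain ⟨φ, C₂, hC₂, h₂⟩ := hK.exists_le_mul_matrix_functional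
    (μ := fun M => ‖M‖) continuous_norm
    (fun c hc M => by rw [norm_smul, Real.norm_of_nonneg hc])
  obtain ⟨C₃, hC₃, h₃⟩ := hν'.exists_linearMap_le_mul (φ ∘ₗ blockSum V (HomExp n p))
  obtain ⟨C₄, hC₄, h₄⟩ := hν.exists_kronecker_symLift_le_mul hp ν'
  have hS : ∀ k, 0 ≤ ∑ s ∈ G.paths k, ν (wordProd A s.2) ^ p := fun k =>
    Finset.sum_nonneg fun s _ => pow_nonneg (apply_nonneg ν _) p
  refine tendsto_rpow_one_div_of_comparable hS (fun k => apply_nonneg ν' _)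
    (C := C₁ * C₂ * C₃) (D := C₄) (by positivity) hC₄ (fun k => ?_) (fun k => ?_)
    (hν'.tendsto_pow_rpow_one_div (liftedSum G A p))
  · have hΦ : (φ ∘ₗ blockSum V (HomExp n p)) (liftedPathSum G A p k) =
        ∑ s ∈ G.paths k, φ (symLift p (wordProd A s.2)) := by
      simp only [liftedPathSum, map_sum, LinearMap.comp_apply, blockSum_single_kronecker]
    have hle := h₃ (liftedPathSum G A p k)
    rw [hΦ, liftedPathSum_eq_pow] at hle
    calc ∑ s ∈ G.paths k, ν (wordProd A s.2) ^ p
        ≤ ∑ s ∈ G.paths k, C₁ * C₂ * φ (symLift p (wordProd A s.2)) := by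
          refine Finset.sum_le_sum fun s _ => (h₁ _).trans ?_
          rw [mul_assoc]
          exact mul_le_mul_of_nonneg_left (h₂ _ (hA.wordProd s.2)) hC₁.le
      _ = C₁ * C₂ * ∑ s ∈ G.paths k, φ (symLift p (wordProd A s.2)) := by rw [Finset.mul_sum]
      _ ≤ C₁ * C₂ * (C₃ * ν' (liftedSum G A p ^ k)) := by gcongr
      _ = C₁ * C₂ * C₃ * ν' (liftedSum G A p ^ k) := by ring
  · rw [← liftedPathSum_eq_pow, liftedPathSum, Finset.mul_sum]
    exact (Finset.le_sum_of_subadditive ν' (map_zero ν').le (map_add_le_add ν') _ _).trans (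
      Finset.sum_le_sum fun s _ => h₄ _ _ _)

theorem pRadiusFormulas_of_invariant_cone (G : Automaton V m) (hG : G.StronglyConnected)
    (hE : G.edges.Nonempty) (A : Fin m → Matrix (Fin n) (Fin n) ℝ) {p : ℕ} (hp : p ≠ 0)
    {K : Set (HomExp n p → ℝ)} (hK : IsProperCone K)
    (hA : LeavesInvariant (fun σ => symLift p (A σ)) K) : PRadiusFormulas G A p := by
  intro ν ν' hν hν'
  have hexp : ∀ k : ℕ, 1 / ((p : ℝ) * k) = 1 / (k : ℝ) * (1 / (p : ℝ)) := fun k => by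
    rw [one_div_mul_one_div, mul_comm]
  have hρ := G.realSpectralRadius_adjacency_pos hG hE
  have hρ' : 0 ≤ realSpectralRadius (liftedSum G A p) := ENNReal.toReal_nonneg
  have hlift : Tendsto (fun k : ℕ => ν' (liftedPathSum G A p k) ^ (1 / ((p : ℝ) * k))) atTop
      (𝓝 (realSpectralRadius (liftedSum G A p) ^ (1 / (p : ℝ)))) := by
    refine ((hν'.tendsto_pow_rpow_one_div (liftedSum G A p)).rpow_const
      (Or.inr (by positivity))).congr fun k => ?_
    rw [hexp, Real.rpow_mul (apply_nonneg ν' _), liftedPathSum_eq_pow]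
  have hrad : Tendsto (pRadiusSeq G A ν p) atTop
      (𝓝 (1 / realSpectralRadius G.adjacency ^ (1 / (p : ℝ)) *
        realSpectralRadius (liftedSum G A p) ^ (1 / (p : ℝ)))) := by
    have h := ((G.tendsto_card_paths.inv₀ hρ.ne').mul
      (tendsto_sum_pow_norm G A hp hK hA hν)).rpow_const (p := 1 / (p : ℝ))
      (Or.inr (by positivity))
    rw [Real.mul_rpow (by positivity) hρ', Real.inv_rpow hρ.le, ← one_div (_ ^ (1 / (p : ℝ)))] at h
    refine h.congr fun k => ?_
    have hS : 0 ≤ ∑ s ∈ G.paths k, ν (wordProd A s.2) ^ p :=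
      Finset.sum_nonneg fun s _ => pow_nonneg (apply_nonneg ν _) p
    rw [pRadiusSeq, sum_outPowerSum, hexp, Real.rpow_mul (by positivity),
      Real.mul_rpow (by positivity) hS, Real.inv_rpow (by positivity)]
  have heq : constrainedPRadius G A ν p = _ := hrad.limUnder_eq
  refine ⟨?_, ⟨_, hlift, heq⟩, heq⟩
  rw [heq]
  exact hrad

end Main

/-! ### Square roots of homogeneous bounds -/

/-- If `g = X ^ k * q` with `k < d`, then `q(t)² ≤ t ^ (2(d - k)) C` for `t ≠ 0`; letting `t` tend
to 0 gives `q(0) = 0`, hence one more factor `X`. -/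
theorem Polynomial.X_pow_dvd_of_sq_eval_le {g : Polynomial ℝ} {d : ℕ} {C : ℝ}
    (h : ∀ t : ℝ, g.eval t ^ 2 ≤ t ^ (2 * d) * C) {k : ℕ} (hk : k ≤ d) :
    Polynomial.X ^ k ∣ g := by
  induction k with
  | zero => simp
  | succ k ih =>
    obtain ⟨q, rfl⟩ := ih (by omega)
    rw [pow_succ]
    refine mul_dvd_mul_left _ (Polynomial.X_dvd_iff.2 ?_)
    rw [Polynomial.coeff_zero_eq_eval_zero]
    have hle : ∀ᶠ t : ℝ in 𝓝[≠] 0, q.eval t ^ 2 ≤ t ^ (2 * (d - k)) * C := by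
      filter_upwards [self_mem_nhdsWithin] with t ht
      have ht : t ≠ 0 := ht
      have h1 := h t
      have hd : 2 * d = 2 * k + 2 * (d - k) := by omega
      rw [Polynomial.eval_mul, Polynomial.eval_pow, Polynomial.eval_X, mul_pow, ← pow_mul, hd,
        pow_add, mul_comm k, mul_assoc] at h1
      exact le_of_mul_le_mul_left h1 ((even_two_mul k).pow_pos ht)
    have h1 : Tendsto (fun t : ℝ => q.eval t ^ 2) (𝓝[≠] 0) (𝓝 (q.eval 0 ^ 2)) :=
      ((q.continuous.pow 2).tendsto 0).mono_left nhdsWithin_le_nhds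
    have h2 : Tendsto (fun t : ℝ => t ^ (2 * (d - k)) * C) (𝓝[≠] 0) (𝓝 0) := by
      have hc : Continuous fun t : ℝ => t ^ (2 * (d - k)) * C := by fun_prop
      have := hc.tendsto 0
      rw [zero_pow (by omega), zero_mul] at this
      exact this.mono_left nhdsWithin_le_nhds
    have h3 := le_of_tendsto_of_tendsto h1 h2 hle
    exact pow_eq_zero_iff two_ne_zero |>.1 (le_antisymm h3 (sq_nonneg _))

theorem Polynomial.eq_C_mul_X_pow_of_sq_eval_le {g : Polynomial ℝ} {d : ℕ} {C : ℝ}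
    (h : ∀ t : ℝ, g.eval t ^ 2 ≤ t ^ (2 * d) * C) : ∃ a, g = Polynomial.C a * Polynomial.X ^ d := by
  obtain ⟨q, rfl⟩ := Polynomial.X_pow_dvd_of_sq_eval_le h le_rfl
  have hdeg : q.degree ≤ 0 := by
    rw [← Polynomial.isBoundedUnder_abs_atTop_iff]
    -- The cofactor satisfies `q² ≤ C` for `t > 0`, and `|q| ≤ q² + 1`. A bounded polynomial is
    -- constant.
    refine ⟨C + 1, eventually_map.2 ?_⟩
    filter_upwards [eventually_gt_atTop 0] with t ht
    have h1 := h t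
    rw [Polynomial.eval_mul, Polynomial.eval_pow, Polynomial.eval_X, mul_pow, ← pow_mul,
      mul_comm d] at h1
    have h2 : q.eval t ^ 2 ≤ C := le_of_mul_le_mul_left h1 (by positivity)
    have h3 := sq_abs (q.eval t)
    nlinarith [sq_nonneg (|q.eval t| - 1), abs_nonneg (q.eval t)]
  rw [Polynomial.eq_C_of_degree_le_zero hdeg]
  exact ⟨_, mul_comm _ _⟩

theorem MvPolynomial.IsHomogeneous.eval_smul {τ : Type*} [Fintype τ] {F : MvPolynomial τ ℝ}
    {d : ℕ} (hF : F.IsHomogeneous d) (t : ℝ) (x : τ → ℝ) :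
    MvPolynomial.eval (t • x) F = t ^ d * MvPolynomial.eval x F := by
  rw [MvPolynomial.eval_eq', MvPolynomial.eval_eq', Finset.mul_sum]
  refine Finset.sum_congr rfl fun α hα => ?_
  have h : ∑ i, α i = d := by
    simpa [Finsupp.weight_apply, Finsupp.sum_fintype] using hF (MvPolynomial.mem_support_iff.1 hα)
  simp only [Pi.smul_apply, smul_eq_mul, mul_pow, Finset.prod_mul_distrib,
    Finset.prod_pow_eq_pow_sum, h]
  ring

/-- On the ray through `x`, `q (t x)² ≤ t ^ (2d) F(x)`, so `t ↦ q (t x)` is a multiple of `t ^ d`.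
Its coefficient of `t ^ j` is the value at `x` of the component of degree `j`. -/
theorem MvPolynomial.isHomogeneous_of_sq_eval_le {τ : Type*} [Fintype τ]
    {q F : MvPolynomial τ ℝ} {d : ℕ} (hF : F.IsHomogeneous (2 * d))
    (h : ∀ x, MvPolynomial.eval x q ^ 2 ≤ MvPolynomial.eval x F) : q.IsHomogeneous d := by
  have hcomp : ∀ j, j ≠ d → MvPolynomial.homogeneousComponent j q = 0 := by
    intro j hj
    refine MvPolynomial.funext fun x => ?_
    rw [map_zero]
    set g : Polynomial ℝ := ∑ i ∈ Finset.range (q.totalDegree + 1),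
      Polynomial.monomial i (MvPolynomial.eval x (MvPolynomial.homogeneousComponent i q)) with hg
    have hev : ∀ t : ℝ, g.eval t = MvPolynomial.eval (t • x) q := by
      intro t
      conv_rhs => rw [← MvPolynomial.sum_homogeneousComponent q]
      rw [hg, Polynomial.eval_finsetSum, map_sum]
      refine Finset.sum_congr rfl fun i _ => ?_
      rw [(MvPolynomial.homogeneousComponent_isHomogeneous i q).eval_smul,
        Polynomial.eval_monomial, mul_comm]
    obtain ⟨a, ha⟩ := Polynomial.eq_C_mul_X_pow_of_sq_eval_le (g := g) (d := d)
      (C := MvPolynomial.eval x F) fun t => by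
        rw [hev, ← hF.eval_smul]
        exact h _
    by_cases hjq : j < q.totalDegree + 1
    · have hcoeff : g.coeff j = MvPolynomial.eval x (MvPolynomial.homogeneousComponent j q) := by
        simp only [hg, Polynomial.finsetSum_coeff, Polynomial.coeff_monomial]
        rw [Finset.sum_ite_eq' , if_pos (Finset.mem_range.2 hjq)]
      rw [← hcoeff, ha, Polynomial.coeff_C_mul, Polynomial.coeff_X_pow, if_neg hj, mul_zero]
    · rw [MvPolynomial.homogeneousComponent_eq_zero _ _ (by omega), map_zero]
  have hq : MvPolynomial.homogeneousComponent d q = q := by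
    conv_rhs => rw [← MvPolynomial.sum_homogeneousComponent q]
    by_cases hd : d ∈ Finset.range (q.totalDegree + 1)
    · rw [Finset.sum_eq_single_of_mem d hd fun j _ hj => hcomp j hj]
    · rw [MvPolynomial.homogeneousComponent_eq_zero _ _ (by
        rw [Finset.mem_range] at hd
        omega)]
      exact (Finset.sum_eq_zero fun j hj => hcomp j fun h => hd (h ▸ hj)).symm
  rw [← hq]
  exact MvPolynomial.homogeneousComponent_isHomogeneous d q

/-! ### Gram matrices -/

section Gram

variable {n d : ℕ}

theorem homExp_mem_iff {α : Fin n →₀ ℕ} :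
    α ∈ Finset.finsuppAntidiag (Finset.univ : Finset (Fin n)) d ↔ ∑ i, α i = d := by
  simp [Finset.mem_finsuppAntidiag]

theorem MvPolynomial.IsHomogeneous.sum_eq {q : MvPolynomial (Fin n) ℝ} (hq : q.IsHomogeneous d)
    {α : Fin n →₀ ℕ} (hα : q.coeff α ≠ 0) : ∑ i, α i = d := by
  simpa [Finsupp.weight_apply, Finsupp.sum_fintype] using hq hα

/-- The coordinates of a form in the scaled monomial basis. -/
noncomputable def coordsOfForm (n d : ℕ) : MvPolynomial (Fin n) ℝ →ₗ[ℝ] (HomExp n d → ℝ) where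
  toFun q α := q.coeff α.1 / scaling α
  map_add' q r := by
    ext α
    simp [add_div]
  map_smul' c q := by
    ext α
    simp [mul_div_assoc]

theorem isHomogeneous_formOfCoords (c : HomExp n d → ℝ) : (formOfCoords c).IsHomogeneous d := by
  refine MvPolynomial.IsHomogeneous.sum _ _ _ fun α _ =>
    MvPolynomial.isHomogeneous_monomial _ ?_
  rw [Finsupp.degree_eq_sum, sum_homExp]

theorem coordsOfForm_formOfCoords (c : HomExp n d → ℝ) :
    coordsOfForm n d (formOfCoords c) = c := by
  ext α
  change (formOfCoords c).coeff α.1 / scaling α = c α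
  rw [coeff_formOfCoords, mul_div_cancel_right₀ _ (scaling_pos α).ne']

theorem formOfCoords_coordsOfForm {q : MvPolynomial (Fin n) ℝ} (hq : q.IsHomogeneous d) :
    formOfCoords (coordsOfForm n d q) = q := by
  ext α
  by_cases hα : ∑ i, α i = d
  · rw [coeff_formOfCoords _ (⟨α, homExp_mem_iff.2 hα⟩ : HomExp n d)]
    exact div_mul_cancel₀ _ (scaling_pos _).ne'
  · rw [not_imp_comm.1 (isHomogeneous_formOfCoords _).sum_eq hα, not_imp_comm.1 hq.sum_eq hα]

/-- The form `x ↦ ⟨x^{[d]}, Q x^{[d]}⟩`. -/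
noncomputable def gramForm (n d : ℕ) :
    Matrix (HomExp n d) (HomExp n d) ℝ →ₗ[ℝ] MvPolynomial (Fin n) ℝ where
  toFun Q := ∑ α, ∑ β, Q α β • (MvPolynomial.monomial α.1 (scaling α) *
    MvPolynomial.monomial β.1 (scaling β))
  map_add' P Q := by simp [add_smul, Finset.sum_add_distrib]
  map_smul' c Q := by simp [mul_smul, Finset.smul_sum]

theorem isHomogeneous_gramForm (Q : Matrix (HomExp n d) (HomExp n d) ℝ) :
    (gramForm n d Q).IsHomogeneous (2 * d) := by
  refine MvPolynomial.IsHomogeneous.sum _ _ _ fun α _ =>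
    MvPolynomial.IsHomogeneous.sum _ _ _ fun β _ => ?_
  rw [MvPolynomial.smul_eq_C_mul]
  refine MvPolynomial.IsHomogeneous.C_mul ?_ _
  rw [two_mul]
  refine MvPolynomial.IsHomogeneous.mul ?_ ?_ <;>
  · refine MvPolynomial.isHomogeneous_monomial _ ?_
    rw [Finsupp.degree_eq_sum, sum_homExp]

theorem gramForm_vecMulVec (b : HomExp n d → ℝ) :
    gramForm n d (Matrix.vecMulVec b b) = formOfCoords b * formOfCoords b := by
  simp only [formOfCoords, Finset.sum_mul_sum]
  change ∑ α, ∑ β, Matrix.vecMulVec b b α β • _ = _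
  refine Finset.sum_congr rfl fun α _ => Finset.sum_congr rfl fun β _ => ?_
  simp only [Matrix.vecMulVec_apply, MvPolynomial.monomial_mul, MvPolynomial.smul_monomial,
    smul_eq_mul]
  congr 1
  ring

theorem IsSumSq.eval_nonneg {F : MvPolynomial (Fin n) ℝ} (hF : IsSumSq F) (x : Fin n → ℝ) :
    0 ≤ MvPolynomial.eval x F := by
  induction hF with
  | zero => simp
  | sq_add q _ ih =>
    rw [map_add, map_mul]
    exact add_nonneg (mul_self_nonneg _) ih

theorem exists_gram_of_isSumSq {F : MvPolynomial (Fin n) ℝ} (hF : IsSumSq F)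
    (hhom : F.IsHomogeneous (2 * d)) :
    ∃ Q : Matrix (HomExp n d) (HomExp n d) ℝ, Q.PosSemidef ∧ gramForm n d Q = F := by
  induction hF with
  | zero => exact ⟨0, Matrix.PosSemidef.zero, map_zero _⟩
  | sq_add q hs ih =>
    -- The remaining sum of squares is nonnegative, so `q²` lies below the form pointwise. Hence `q`
    -- is homogeneous, and so is the remainder, as the induction requires.
    have hq : q.IsHomogeneous d := MvPolynomial.isHomogeneous_of_sq_eval_le hhom fun x => by
      rw [map_add, map_mul, ← sq]
      exact le_add_of_nonneg_right (hs.eval_nonneg x)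
    have hqq : (q * q).IsHomogeneous (2 * d) := two_mul d ▸ hq.mul hq
    obtain ⟨Q, hQ, hQF⟩ := ih (by simpa using hhom.sub hqq)
    refine ⟨Matrix.vecMulVec (coordsOfForm n d q) (coordsOfForm n d q) + Q, ?_, ?_⟩
    · simpa using (Matrix.posSemidef_vecMulVec_self_star (coordsOfForm n d q)).add hQ
    · rw [map_add, gramForm_vecMulVec, formOfCoords_coordsOfForm hq, hQF]

theorem Matrix.PosSemidef.exists_gramForm_eq_sum {Q : Matrix (HomExp n d) (HomExp n d) ℝ}
    (hQ : Q.PosSemidef) : ∃ (r : ℕ) (b : Fin r → HomExp n d → ℝ),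
      Q = ∑ i, Matrix.vecMulVec (b i) (b i) ∧
      gramForm n d Q = ∑ i, formOfCoords (b i) * formOfCoords (b i) := by
  obtain ⟨r, b, hb⟩ := Matrix.posSemidef_iff_eq_sum_vecMulVec.1 hQ
  simp only [star_trivial] at hb
  refine ⟨r, b, hb, ?_⟩
  rw [hb, map_sum]
  exact Finset.sum_congr rfl fun i _ => gramForm_vecMulVec _

theorem Matrix.PosSemidef.eq_zero_of_gramForm_eq_zero {Q : Matrix (HomExp n d) (HomExp n d) ℝ}
    (hQ : Q.PosSemidef) (h : gramForm n d Q = 0) : Q = 0 := by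
  obtain ⟨r, b, hb, hg⟩ := hQ.exists_gramForm_eq_sum
  have hzero : ∀ i, b i = 0 := by
    intro i
    refine formOfCoords_eq_zero (MvPolynomial.funext fun x => ?_)
    have hx := congrArg (MvPolynomial.eval x) hg
    rw [h, map_zero, map_sum] at hx
    simp only [map_mul] at hx
    have := (Finset.sum_eq_zero_iff_of_nonneg fun i _ => mul_self_nonneg _).1 hx.symm i
      (Finset.mem_univ i)
    rw [map_zero]
    exact mul_self_eq_zero.1 this
  rw [hb]
  simp [hzero]

theorem sosCone_eq_image : sosCone n (2 * d) =
    (coordsOfForm n (2 * d) ∘ₗ gramForm n d) '' {Q | Q.PosSemidef} := by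
  ext c
  constructor
  · intro hc
    obtain ⟨Q, hQ, h⟩ := exists_gram_of_isSumSq hc (isHomogeneous_formOfCoords c)
    exact ⟨Q, hQ, by rw [LinearMap.comp_apply, h, coordsOfForm_formOfCoords]⟩
  · rintro ⟨Q, hQ, rfl⟩
    obtain ⟨r, b, -, hg⟩ := Matrix.PosSemidef.exists_gramForm_eq_sum hQ
    change IsSumSq (formOfCoords _)
    rw [LinearMap.comp_apply, formOfCoords_coordsOfForm (isHomogeneous_gramForm Q), hg]
    exact IsSumSq.sum_mul_self _ _

end Gram

/-! ### The cone of sums of squares is proper and invariant -/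

/-- Injectivity at 0 on the cone gives `‖x‖ ≤ C ‖L x‖`, so preimages of a convergent sequence are
bounded and have a convergent subsequence. -/
theorem LinearMap.isClosed_image_of_cone {E F : Type*} [NormedAddCommGroup E] [NormedSpace ℝ E]
    [FiniteDimensional ℝ E] [NormedAddCommGroup F] [NormedSpace ℝ F] (L : E →ₗ[ℝ] F) {S : Set E}
    (hS : IsClosed S) (hcone : ∀ c : ℝ, 0 ≤ c → ∀ x ∈ S, c • x ∈ S)
    (hL : ∀ x ∈ S, L x = 0 → x = 0) : IsClosed (L '' S) := by
  have hproper : ProperSpace E := FiniteDimensional.proper ℝ E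
  have hLc : Continuous L := L.continuous_of_finiteDimensional
  obtain ⟨C, hC, h⟩ := exists_le_mul_of_homogeneous hS hcone one_ne_zero
    (f := fun x => ‖x‖) (g := fun x => ‖L x‖) continuous_norm hLc.norm
    (fun c hc x => by rw [norm_smul, Real.norm_of_nonneg hc, pow_one])
    (fun c hc x => by rw [map_smul, norm_smul, Real.norm_of_nonneg hc, pow_one])
    (fun x hx hx0 => norm_pos_iff.2 fun h => hx0 (hL x hx h))
  refine IsSeqClosed.isClosed fun y z hy hz => ?_
  choose x hxS hxy using hy
  obtain ⟨R, hR⟩ := hz.norm.bddAbove_range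
  have hbd : ∀ k, x k ∈ Metric.closedBall (0 : E) (C * R) := by
    intro k
    rw [mem_closedBall_zero_iff]
    refine (h _ (hxS k)).trans (mul_le_mul_of_nonneg_left ?_ hC.le)
    rw [hxy]
    exact hR ⟨k, rfl⟩
  obtain ⟨a, -, φ, hφ, ha⟩ := tendsto_subseq_of_bounded Metric.isBounded_closedBall hbd
  refine ⟨a, hS.mem_of_tendsto ha (Eventually.of_forall fun k => hxS _), ?_⟩
  refine tendsto_nhds_unique ((hLc.tendsto a).comp ha) ?_
  refine (hz.comp hφ.tendsto_atTop).congr fun k => ?_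
  simp [hxy]

section SosCone

variable {n d : ℕ}

theorem formOfCoords_add (b c : HomExp n d → ℝ) :
    formOfCoords (b + c) = formOfCoords b + formOfCoords c := by
  simp [formOfCoords, add_mul, Finset.sum_add_distrib]

theorem formOfCoords_smul (t : ℝ) (c : HomExp n d → ℝ) :
    formOfCoords (t • c) = MvPolynomial.C t * formOfCoords c := by
  simp [formOfCoords, Finset.mul_sum, MvPolynomial.C_mul_monomial, mul_assoc]

theorem smul_mem_sosCone {t : ℝ} (ht : 0 ≤ t) {c : HomExp n d → ℝ} (hc : c ∈ sosCone n d) :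
    t • c ∈ sosCone n d := by
  change IsSumSq (formOfCoords _)
  rw [formOfCoords_smul]
  refine IsSumSq.mul ?_ hc
  rw [← Real.mul_self_sqrt ht, map_mul]
  exact IsSumSq.mul_self _

theorem convex_sosCone : Convex ℝ (sosCone n d) := by
  intro x hx y hy a b ha hb _
  change IsSumSq (formOfCoords _)
  rw [formOfCoords_add]
  exact (smul_mem_sosCone ha hx).add (smul_mem_sosCone hb hy)

section

attribute [local instance] Matrix.normedAddCommGroup Matrix.normedSpace

theorem isClosed_sosCone : IsClosed (sosCone n (2 * d)) := by
  rw [sosCone_eq_image]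
  refine LinearMap.isClosed_image_of_cone _ ?_ (fun c hc Q hQ => Matrix.PosSemidef.smul hQ hc)
    fun Q hQ h => ?_
  · simp only [Matrix.posSemidef_iff_dotProduct_mulVec, Set.ofPred_and, Set.ofPred_forall]
    refine IsClosed.inter (isClosed_eq continuous_id.matrix_conjTranspose continuous_id)
      (isClosed_iInter fun x => isClosed_le continuous_const ?_)
    exact Continuous.dotProduct continuous_const
      (Continuous.matrix_mulVec continuous_id continuous_const)
  · refine Matrix.PosSemidef.eq_zero_of_gramForm_eq_zero hQ ?_
    have h : coordsOfForm n (2 * d) (gramForm n d Q) = 0 := h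
    rw [← formOfCoords_coordsOfForm (isHomogeneous_gramForm Q), h]
    simp [formOfCoords]

end

/-- The form with coordinates `y^{[d]}` is the `d`-th power of the linear form `⟨y, x⟩`. -/
theorem formOfCoords_scaledMonomials (y : Fin n → ℝ) :
    formOfCoords (scaledMonomials d y) =
      (∑ i, MvPolynomial.C (y i) * MvPolynomial.X i) ^ d := by
  refine MvPolynomial.funext fun x => ?_
  rw [eval_formOfCoords, scaledMonomials_dotProduct]
  simp [dotProduct]

theorem scaledMonomials_mem_sosCone (y : Fin n → ℝ) :
    scaledMonomials (2 * d) y ∈ sosCone n (2 * d) := by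
  change IsSumSq (formOfCoords _)
  rw [formOfCoords_scaledMonomials, two_mul, pow_add]
  exact IsSumSq.mul_self _

/-- A functional killing every `y^{[d]}` is pairing with a form that vanishes everywhere, hence
zero. -/
theorem eq_top_of_scaledMonomials_mem {W : Submodule ℝ (HomExp n d → ℝ)}
    (hW : ∀ y, scaledMonomials d y ∈ W) : W = ⊤ := by
  classical
  by_contra hne
  obtain ⟨f, hf, hfW⟩ := Submodule.exists_le_ker_of_lt_top W (lt_top_iff_ne_top.2 hne)
  have hrep : ∀ v, f v = (fun α => f (Pi.single α 1)) ⬝ᵥ v := by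
    intro v
    conv_lhs => rw [LinearMap.pi_apply_eq_sum_univ f v]
    simp only [dotProduct, smul_eq_mul]
    refine Finset.sum_congr rfl fun α _ => ?_
    rw [mul_comm]
    congr 2
    ext β
    simp [Pi.single_apply, eq_comm]
  have hz : (fun α => f (Pi.single α 1)) = 0 :=
    eq_zero_of_dotProduct_scaledMonomials fun y => by
      rw [← hrep]
      exact hfW (hW y)
  refine hf (LinearMap.ext fun v => ?_)
  rw [hrep, hz, zero_dotProduct, LinearMap.zero_apply]

theorem zero_mem_sosCone : (0 : HomExp n d → ℝ) ∈ sosCone n d := by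
  change IsSumSq (formOfCoords _)
  simp [formOfCoords]

theorem isProperCone_sosCone : IsProperCone (sosCone n (2 * d)) where
  smul_mem t ht c hc := smul_mem_sosCone ht hc
  convex := convex_sosCone
  isClosed := isClosed_sosCone
  solid := by
    -- A convex set in finite dimension has interior exactly when its affine span is everything; as
    -- the cone contains 0, it is enough that the vectors `y^{[2d]}` span.
    rw [convex_sosCone.interior_nonempty_iff_affineSpan_eq_top,
      AffineSubspace.affineSpan_eq_top_iff_vectorSpan_eq_top_of_nonempty _ _ _
        ⟨_, zero_mem_sosCone⟩]
    refine eq_top_of_scaledMonomials_mem fun y => ?_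
    simpa using vsub_mem_vectorSpan ℝ (scaledMonomials_mem_sosCone y)
      (zero_mem_sosCone (n := n) (d := 2 * d))
  pointed c hc hc' := by
    refine formOfCoords_eq_zero (MvPolynomial.funext fun x => ?_)
    have h1 := IsSumSq.eval_nonneg hc x
    have h2 := IsSumSq.eval_nonneg hc' x
    rw [eval_formOfCoords, neg_dotProduct, ← eval_formOfCoords] at h2
    rw [map_zero]
    linarith

/-- By `symLift_transpose`, applying the lift to `c` substitutes `Aᵀ x` for `x` in its form, and a
ring homomorphism preserves sums of squares. -/
theorem symLift_mulVec_mem_sosCone (A : Matrix (Fin n) (Fin n) ℝ) {c : HomExp n d → ℝ}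
    (hc : c ∈ sosCone n d) : (symLift d A).mulVec c ∈ sosCone n d := by
  have h : formOfCoords ((symLift d A).mulVec c) = MvPolynomial.bind₁
      (fun i => ∑ j, MvPolynomial.C (A.transpose i j) * MvPolynomial.X j) (formOfCoords c) := by
    refine MvPolynomial.funext fun x => ?_
    have hx : (fun i => MvPolynomial.eval x
        (∑ j, MvPolynomial.C (A.transpose i j) * MvPolynomial.X j)) = A.transpose.mulVec x := by
      ext i
      simp [Matrix.mulVec, dotProduct]
    rw [MvPolynomial.eval, MvPolynomial.eval₂Hom_bind₁, ← MvPolynomial.eval]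
    change _ = MvPolynomial.eval (fun i => MvPolynomial.eval x _) _
    rw [hx, eval_formOfCoords, eval_formOfCoords, ← symLift_mulVec, symLift_transpose,
      Matrix.mulVec_transpose, dotProduct_comm c, ← Matrix.dotProduct_mulVec, dotProduct_comm]
  change IsSumSq (formOfCoords _)
  rw [h]
  have hc : IsSumSq (formOfCoords c) := hc
  generalize formOfCoords c = F at hc
  induction hc with
  | zero => simp
  | sq_add q _ ih =>
    rw [map_add, map_mul]
    exact IsSumSq.sq_add _ ih

end SosCone

theorem mainTheorem8 {V : Type*} [Fintype V] [DecidableEq V] {n m : ℕ}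
    (G : Automaton V m) (hG : G.StronglyConnected) (hE : G.edges.Nonempty)
    (A : Fin m → Matrix (Fin n) (Fin n) ℝ) :
    (∀ p : ℕ, 1 ≤ p →
      (∃ K : Set (HomExp n p → ℝ),
        IsProperCone K ∧ LeavesInvariant (fun σ => symLift p (A σ)) K) →
      PRadiusFormulas G A p) ∧
    (∀ d : ℕ, 1 ≤ d →
      (IsProperCone (sosCone n (2 * d)) ∧
        LeavesInvariant (fun σ => symLift (2 * d) (A σ)) (sosCone n (2 * d))) ∧
      PRadiusFormulas G A (2 * d)) := by
  refine ⟨fun p hp ⟨K, hK, hA⟩ =>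
    pRadiusFormulas_of_invariant_cone G hG hE A (by omega) hK hA, fun d hd => ?_⟩
  have hinv : LeavesInvariant (fun σ => symLift (2 * d) (A σ)) (sosCone n (2 * d)) :=
    fun σ c hc => symLift_mulVec_mem_sosCone (A σ) hc
  exact ⟨⟨isProperCone_sosCone, hinv⟩,
    pRadiusFormulas_of_invariant_cone G hG hE A (by omega) isProperCone_sosCone hinv⟩
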